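/- Permutations are permutations of $\{1,\dots,n\}$, $n\ge 0$; $n$ is the length $|\pi|$ of $\pi$. A permutation $\pi$ contains $\sigma$ if $\pi$ has a subsequence order isomorphic to $\sigma$, and a permutation class is a set of permutations closed downwards under containment. Let $M$ be a $0/\pm1$ matrix with $t$ columns and $u$ rows, where $M_{k,\ell}$ is the entry in column $k$ (counted from the left) and row $\ell$ (counted from the bottom). The standard figure of $M$ is the set of points of $\mathbb{R}^2$ consisting of the open line segments from $(k-1,\ell-1)$ to $(k,\ell)$ for all $k,\ell$ with $M_{k,\ell}=1$ and the open line segments from $(k-1,\ell)$ to $(k,\ell-1)$ for all $k,\ell$ with $M_{k,\ell}=-1$. The geometric grid class $\operatorname{Geom}(M)$ is the set of all permutations obtained by choosing finitely many points of this figure, no two on a common horizontal or vertical line, labelling them $1,2,\dots,n$ from bottom to top and reading the labels from left to right. A permutation class is geometrically griddable if it is contained in $\operatorname{Geom}(M)$ for some $0/\pm1$ matrix $M$. Theorem. Let $\mathcal{C}$ be a geometrically griddable permutation class. Then there are a finite alphabet $\Sigma$, a regular language $L\subseteq\Sigma^*$ and a bijection $e:\mathcal{C}\to L$ such that, for every $\pi\in\mathcal{C}$,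 the word $e(\pi)$ has exactly $|\pi|$ letters. Moreover, the generating function $\sum_{\pi\in\mathcal{C}}x^{|\pi|}=\sum_{n\ge0}|\mathcal{C}_n|x^n$, where $\mathcal{C}_n$ is the set of permutations of length $n$ in $\mathcal{C}$, is rational, i.e. it equals $P(x)/Q(x)$ as a formal power series for some polynomials $P,Q\in\mathbb{Q}[x]$ with $Q(0)\neq0$. -/

import Mathlib

open scoped Polynomial PowerSeries

namespace GeomGrid

/-- A permutation of arbitrary finite length `n ≥ 0` (positions and values are both indexed by
`0, …, n - 1`). -/
abbrev Permutation : Type := Σ n : ℕ, Equiv.Perm (Fin n)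

/-- The length of a permutation. -/
def Permutation.length (π : Permutation) : ℕ := π.1

/-- `Involved σ π`: the permutation `π` has a subsequence order isomorphic to `σ`. -/
def Involved (σ π : Permutation) : Prop :=
  ∃ f : Fin σ.1 → Fin π.1, StrictMono f ∧
    ∀ i j, σ.2 i < σ.2 j ↔ π.2 (f i) < π.2 (f j)

/-- A permutation class is a downset of permutations under involvement. -/
def IsPermClass (C : Set Permutation) : Prop :=
  ∀ σ π : Permutation, π ∈ C → Involved σ π → σ ∈ C

/-- The standard figure of a `0/±1` matrix with `t` columns (the first index, left to right) and
`u` rows (the second index, bottom to top).  Cell `(k, l)`, counted from zero, is the unit square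
with lower left corner `(k, l)`. -/
def standardFigure {t u : ℕ} (M : Matrix (Fin t) (Fin u) SignType) : Set (ℝ × ℝ) :=
  {p | ∃ (k : Fin t) (l : Fin u),
    (M k l = 1 ∧ p ∈ openSegment ℝ ((k : ℝ), (l : ℝ)) ((k : ℝ) + 1, (l : ℝ) + 1)) ∨
    (M k l = -1 ∧ p ∈ openSegment ℝ ((k : ℝ), (l : ℝ) + 1) ((k : ℝ) + 1, (l : ℝ)))}

/-- The permutations that can be drawn on a figure `F`: there are points of `F`, listed from left
to right as `p 0, …, p (n - 1)`, no two on a common vertical or horizontal line, such that labelling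
them from bottom to top and reading the labels from left to right gives the permutation. -/
def Sub (F : Set (ℝ × ℝ)) : Set Permutation :=
  {π | ∃ p : Fin π.1 → ℝ × ℝ, (∀ i, p i ∈ F) ∧ StrictMono (fun i => (p i).1) ∧
    ∀ i j, π.2 i < π.2 j ↔ (p i).2 < (p j).2}

/-- The geometric grid class of a `0/±1` matrix. -/
def Geom {t u : ℕ} (M : Matrix (Fin t) (Fin u) SignType) : Set Permutation :=
  Sub (standardFigure M)

/-- A geometrically griddable class is a permutation class contained in some geometric grid
class. -/
def IsGeometricallyGriddable (C : Set Permutation) : Prop :=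
  IsPermClass C ∧ ∃ (t u : ℕ) (M : Matrix (Fin t) (Fin u) SignType), C ⊆ Geom M

/-- The generating function of a set of permutations: the coefficient of `x ^ n` is the number of
its members of length `n`. -/
noncomputable def genFun (C : Set Permutation) : ℚ⟦X⟧ :=
  PowerSeries.mk fun n => (Set.ncard {π : Equiv.Perm (Fin n) | (⟨n, π⟩ : Permutation) ∈ C} : ℚ)

/-- A formal power series is rational if it is the quotient `P / Q` of two polynomials, where `Q`
has nonzero constant term. -/
def IsRationalSeries (f : ℚ⟦X⟧) : Prop :=
  ∃ P Q : ℚ[X], Q.coeff 0 ≠ 0 ∧ (Q : ℚ⟦X⟧) * f = (P : ℚ⟦X⟧)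

end GeomGrid

/-!
Every member of a geometric grid class can be encoded by a word of the same length. Cut each column
and each row of the standard figure at its centre. Every point of the figure then lies in one of
finitely many half cells, at the same distance ("time") from the centre of its column and of its
row, and listing the half cells of the points in the order of their times gives a word. Conversely
the word determines the permutation: two points in different half columns are ordered by these, and
two points in the same half column by their times, forwards in right halves and backwards in left
halves; the same holds for rows (`Before`, `IsDrawing`, `Encodes`,
`exists_encodes_of_mem_geom`).

Subwords encode involved permutations, so the words encoding members of a permutation class form a
subword-closed language, and such a language is regular by Higman's lemma
(`Language.isRegular_of_sublist_closed`). It remains to choose, in a regular way, one word for each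
permutation. A permutation may have several words for two reasons.

* Its points may be distributed among the cells in several ways. The distribution chosen is the one
  that is least lexicographically when read from left to right. A word over pairs of cells can carry
  two distributions at once, and the condition that both give the same permutation
  (`IsRedrawing`) is again closed under subwords, hence regular. That the second distribution is
  smaller (`IsDecrease`) is regular too, and projecting the intersection to first components gives
  the words to be excluded.
* For a given distribution the words differ only by the exchange of adjacent cells that share
  neither half column nor half row. The lexicographically least words are those without a certain
  pattern (`HasDescent`, `Encodes.hasDescent_of_lt`, `Encodes.exists_lt_of_hasDescent`), as
  for normal forms in trace monoids.

The words that survive are in length-preserving bijection with the class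
(`exists_isRegular_equiv`), and the generating function of a regular language is rational by the
transfer matrix method (`Language.IsRegular.exists_polynomial_mul_eq`).
-/

/-! ### Regular languages -/

namespace Language

variable {α β : Type}

/-- A variant of Myhill–Nerode: it is enough that the left quotient by `x` depends only on a value
`F x` taken from a finite set. -/
theorem IsRegular.of_finite_range {L : Language α} {S : Type*} (F : List α → S)
    (hF : (Set.range F).Finite) (h : ∀ x y z, F x = F y → x ++ z ∈ L → y ++ z ∈ L) :
    L.IsRegular := by
  apply IsRegular.of_finite_range_leftQuotient
  have hfac : Function.FactorsThrough L.leftQuotient F := fun x y hxy =>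
    Set.ext fun z => ⟨h x y z hxy, h y x z hxy.symm⟩
  have : L.leftQuotient = Function.extend F L.leftQuotient (fun _ => 0) ∘ F :=
    funext fun x => (hfac.extend_apply _ x).symm
  rw [this, Set.range_comp]
  exact hF.image _

theorem IsRegular.mul {L₁ L₂ : Language α} (h₁ : L₁.IsRegular) (h₂ : L₂.IsRegular) :
    (L₁ * L₂).IsRegular := by
  refine IsRegular.of_finite_range
    (fun x => (L₁.leftQuotient x, L₂.leftQuotient '' {y | ∃ u ∈ L₁, u ++ y = x}))
    ((h₁.finite_range_leftQuotient.prod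
      h₂.finite_range_leftQuotient.finite_subsets).subset ?_) ?_
  · rintro _ ⟨x, rfl⟩
    exact ⟨⟨x, rfl⟩, Set.image_subset_range _ _⟩
  · intro x y z hxy hz
    simp only [Prod.mk.injEq] at hxy
    obtain ⟨hq, hs⟩ := hxy
    rw [Language.mem_mul] at hz ⊢
    obtain ⟨a, ha, b, hb, hab⟩ := hz
    rcases List.append_eq_append_iff.1 hab with ⟨c, rfl, rfl⟩ | ⟨c, rfl, rfl⟩
    · have hc : L₂.leftQuotient c ∈ L₂.leftQuotient '' {y' | ∃ u ∈ L₁, u ++ y' = y} := by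
        rw [← hs]
        exact ⟨c, ⟨a, ha, rfl⟩, rfl⟩
      obtain ⟨c', ⟨u, hu, rfl⟩, hc'⟩ := hc
      refine ⟨u, hu, c' ++ z, ?_, by simp⟩
      have : z ∈ L₂.leftQuotient c := hb
      rwa [← hc'] at this
    · have : c ∈ L₁.leftQuotient x := ha
      rw [hq] at this
      exact ⟨y ++ c, this, b, hb, by simp⟩

theorem IsRegular.map (f : α → β) {L : Language α} (h : L.IsRegular) :
    (Language.map f L).IsRegular := by
  refine IsRegular.of_finite_range
    (fun x => L.leftQuotient '' {u | u.map f = x})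
    (h.finite_range_leftQuotient.finite_subsets.subset ?_) ?_
  · rintro _ ⟨x, rfl⟩
    exact Set.image_subset_range _ _
  · rintro x y z hxy ⟨w, hw, hwz⟩
    obtain ⟨a, b, rfl, rfl, rfl⟩ := List.map_eq_append_iff.1 hwz
    have ha : L.leftQuotient a ∈ L.leftQuotient '' {u | u.map f = y} := by
      rw [← hxy]
      exact ⟨a, rfl, rfl⟩
    obtain ⟨a', rfl, ha'⟩ := ha
    have hb : b ∈ L.leftQuotient a := hw
    rw [← ha'] at hb
    exact ⟨a' ++ b, hb, by simp⟩

theorem isRegular_singleton (a : List α) : ({a} : Language α).IsRegular := by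
  refine IsRegular.of_finite_range_leftQuotient
    ((List.finite_toSet (a.tails.map fun s => ({s} : Set (List α)))).insert ∅ |>.subset ?_)
  rintro _ ⟨x, rfl⟩
  by_cases hx : x <+: a
  · obtain ⟨s, rfl⟩ := hx
    refine Or.inr (List.mem_map.2 ⟨s, by simp, ?_⟩)
    ext y
    exact ⟨fun h => by rw [show y = s from h]; rfl,
      fun h => List.append_cancel_left (show x ++ y = x ++ s from h)⟩
  · refine Or.inl (Set.eq_empty_of_forall_notMem fun y hy => hx ⟨y, hy⟩)

/-- The language of all words with letters in `S`. -/
def wordsOver (S : Set α) : Language α := {w | ∀ a ∈ w, a ∈ S}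

theorem isRegular_wordsOver (S : Set α) : (wordsOver S).IsRegular := by
  refine IsRegular.of_finite_range (S := Prop) (fun w => ∀ a ∈ w, a ∈ S) (Set.toFinite _) ?_
  intro x y z hxy (h : ∀ a ∈ x ++ z, a ∈ S) a ha
  simp only [eq_iff_iff] at hxy
  rcases List.mem_append.1 ha with ha | ha
  · exact hxy.1 (fun a ha => h a (List.mem_append_left _ ha)) a ha
  · exact h a (List.mem_append_right _ ha)

theorem IsRegular.iUnion {ι : Type*} [Finite ι] {L : ι → Language α}
    (h : ∀ i, (L i).IsRegular) : Language.IsRegular (T := α) {w | ∃ i, w ∈ L i} := by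
  refine IsRegular.of_finite_range (fun x i => (L i).leftQuotient x)
    ((Set.Finite.pi' fun i => (h i).finite_range_leftQuotient).subset ?_) ?_
  · rintro _ ⟨x, rfl⟩ i
    exact ⟨x, rfl⟩
  · rintro x y z hxy ⟨i, hi⟩
    have : z ∈ (L i).leftQuotient x := hi
    rw [show (L i).leftQuotient x = (L i).leftQuotient y from congrFun hxy i] at this
    exact ⟨i, this⟩

/-- Higman's lemma for words over a finite alphabet: subword order is a well quasi-order. -/
theorem wellQuasiOrdered_sublist [Finite α] :
    WellQuasiOrdered (List.Sublist : List α → List α → Prop) := by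
  have h := Set.PartiallyWellOrderedOn.partiallyWellOrderedOn_sublistForall₂ (α := α) (· = ·)
    (s := Set.univ) (Set.finite_univ.partiallyWellOrderedOn)
  intro f
  obtain ⟨m, n, hmn, hf⟩ := h (fun n => ⟨f n, fun _ _ => trivial⟩)
  refine ⟨m, n, hmn, ?_⟩
  obtain ⟨l, hl, hl'⟩ := List.sublistForall₂_iff.1 hf
  rw [List.forall₂_eq_eq_eq] at hl
  exact (show f m = l from hl) ▸ hl'

/-- A subword-closed language over a finite alphabet is regular. Its left quotients are themselves
subword-closed and decrease along the subword order; an infinite set of them would give an infinite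
strictly decreasing chain of subword-closed languages, which Higman's lemma forbids. -/
theorem isRegular_of_sublist_closed [Finite α] {L : Language α}
    (h : ∀ v w, v.Sublist w → w ∈ L → v ∈ L) : L.IsRegular := by
  apply IsRegular.of_finite_range_leftQuotient
  by_contra hinf
  let q := Set.Infinite.natEmbedding _ hinf
  choose w hw using fun n => (q n).2
  have : IsPreorder (List α) List.Sublist :=
    { refl := List.Sublist.refl, trans := fun _ _ _ => List.Sublist.trans }
  obtain ⟨g, hg⟩ := wellQuasiOrdered_sublist.exists_monotone_subseq w
  have hdec : ∀ m n, m ≤ n → ∀ v, v ∈ L.leftQuotient (w (g n)) → v ∈ L.leftQuotient (w (g m)) :=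
    fun m n hmn v hv => h _ _ ((hg m n hmn).append_right v) hv
  have hne : ∀ n, ∃ v, v ∈ L.leftQuotient (w (g n)) ∧ v ∉ L.leftQuotient (w (g (n + 1))) := by
    intro n
    by_contra! hcon
    have : L.leftQuotient (w (g n)) = L.leftQuotient (w (g (n + 1))) :=
      Set.ext fun v => ⟨hcon v, hdec n (n + 1) n.le_succ v⟩
    rw [hw, hw] at this
    exact absurd (g.injective (q.injective (Subtype.ext this))) (by simp)
  choose v hv hv' using hne
  obtain ⟨m, n, hmn, hs⟩ := wellQuasiOrdered_sublist v
  exact hv' m (h _ _ (hs.append_left _) (hdec (m + 1) n hmn _ (hv n)))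

/-- The number of words of each length in a regular language over a finite alphabet has a rational
generating function. For an automaton with transition matrix `T`, the generating functions of the
languages accepted from the various states form a vector `F` with `(1 - x T) F = (acceptance)`,
and Cramer's rule applies. -/
theorem IsRegular.exists_polynomial_mul_eq [Fintype α] {L : Language α} (hL : L.IsRegular) :
    ∃ P Q : ℚ[X], Q.coeff 0 ≠ 0 ∧
      (Q : ℚ⟦X⟧) * PowerSeries.mk (fun n => (Set.ncard {w : List α | w ∈ L ∧ w.length = n} : ℚ))
        = (P : ℚ⟦X⟧) := by
  classical
  obtain ⟨σ, _, M, rfl⟩ := hL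
  let N : σ → ℕ → Set (List α) := fun s n => {w | w ∈ M.acceptsFrom s ∧ w.length = n}
  have hsucc : ∀ s n, (N s (n + 1)).ncard = ∑ a : α, (N (M.step s a) n).ncard := by
    intro s n
    have : N s (n + 1) = ⋃ a : α, (List.cons a) '' N (M.step s a) n := by
      ext w
      cases w with
      | nil => simp [N]
      | cons b w => simp [N, DFA.mem_acceptsFrom, DFA.evalFrom_cons]
    rw [this, Set.ncard_iUnion_of_finite, finsum_eq_sum_of_fintype]
    · exact Finset.sum_congr rfl fun a _ => Set.ncard_image_of_injective _ List.cons_injective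
    · exact fun a => ((List.finite_length_eq α n).subset fun w hw => hw.2).image _
    · intro a b hab
      rw [Function.onFun, Set.disjoint_left]
      rintro _ ⟨v, _, rfl⟩ ⟨w, _, hw⟩
      exact hab (List.cons.inj hw).1.symm
  let acc : σ → ℚ := fun s => if s ∈ M.accept then 1 else 0
  have hzero : ∀ s, ((N s 0).ncard : ℚ) = acc s := by
    intro s
    by_cases hs : s ∈ M.accept
    · have : N s 0 = {[]} := by
        ext w
        simp only [N, List.length_eq_zero_iff, Set.mem_ofPred_eq, Set.mem_singleton_iff,
          and_iff_right_iff_imp]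
        rintro rfl
        exact hs
      simp [acc, hs, this]
    · have : N s 0 = ∅ := by
        ext w
        simp only [N, List.length_eq_zero_iff, Set.mem_ofPred_eq, Set.mem_empty_iff_false, iff_false]
        rintro ⟨hw, rfl⟩
        exact hs hw
      simp [acc, hs, this]
  let F : σ → ℚ⟦X⟧ := fun s => PowerSeries.mk fun n => ((N s n).ncard : ℚ)
  have hF : ∀ s, F s = PowerSeries.C (acc s) + PowerSeries.X * ∑ a, F (M.step s a) := by
    intro s
    ext n
    cases n with
    | zero => simp [F, hzero]
    | succ n => simp [F, hsucc, PowerSeries.coeff_succ_X_mul]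
  let B : Matrix σ σ ℚ[X] := Matrix.of fun s s' => ∑ a : α, if M.step s a = s' then 1 else 0
  let A : Matrix σ σ ℚ[X] := 1 - (Polynomial.X : ℚ[X]) • B
  let φ : ℚ[X] →+* ℚ⟦X⟧ := Polynomial.coeToPowerSeries.ringHom
  have hB : ∀ s, (φ.mapMatrix B).mulVec F s = ∑ a, F (M.step s a) := by
    intro s
    simp only [Matrix.mulVec, dotProduct, RingHom.mapMatrix_apply, Matrix.map_apply, B,
      Matrix.of_apply, map_sum, Finset.sum_mul]
    rw [Finset.sum_comm]
    refine Finset.sum_congr rfl fun a _ => ?_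
    rw [Finset.sum_eq_single (M.step s a)]
    · simp
    · intro b _ hb
      simp [hb.symm]
    · simp
  have hA : φ.mapMatrix A = 1 - (PowerSeries.X : ℚ⟦X⟧) • φ.mapMatrix B := by
    ext1 s s'
    simp [A, φ, Matrix.one_apply]
    split_ifs <;> simp
  have hAF : (φ.mapMatrix A).mulVec F = fun s => φ (Polynomial.C (acc s)) := by
    ext1 s
    rw [hA, Matrix.sub_mulVec, Matrix.one_mulVec, Matrix.smul_mulVec, Pi.sub_apply,
      Pi.smul_apply, hB, hF s]
    simp [φ]
  have hdet : φ A.det • F =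
      (φ.mapMatrix A.adjugate).mulVec fun s => φ (Polynomial.C (acc s)) := by
    rw [← hAF, Matrix.mulVec_mulVec, ← map_mul, Matrix.adjugate_mul]
    ext1 s
    simp [Matrix.mulVec, dotProduct, Matrix.one_apply, apply_ite φ]
  refine ⟨A.adjugate.mulVec (fun s => Polynomial.C (acc s)) M.start, A.det, ?_, ?_⟩
  · have h1 : Polynomial.constantCoeff.mapMatrix A = 1 := by
      ext1 s s'
      rcases eq_or_ne s s' with rfl | h
      · simp [A]
      · simp [A, h]
    have h2 : Polynomial.constantCoeff A.det = 1 := by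
      rw [RingHom.map_det, h1, Matrix.det_one]
    rw [← Polynomial.constantCoeff_apply, h2]
    exact one_ne_zero
  · have := congrFun hdet M.start
    simp only [Pi.smul_apply, smul_eq_mul] at this
    exact this.trans
      (RingHom.map_mulVec φ A.adjugate (fun s => Polynomial.C (acc s)) M.start).symm

end Language

namespace GeomGrid

/-! ### Languages given by predicates on tuples -/

section LangOf

variable {α β : Type}

/-- The language of all words which, read as tuples indexed by `Fin n`, satisfy `P`. -/
def langOf (P : ∀ n, (Fin n → α) → Prop) : Language α := {w | P w.length w.get}

theorem mem_langOf {P : ∀ n, (Fin n → α) → Prop} {w : List α} :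
    w ∈ langOf P ↔ P w.length w.get := Iff.rfl

theorem ofFn_mem_langOf {P : ∀ n, (Fin n → α) → Prop} {n : ℕ} {v : Fin n → α} :
    List.ofFn v ∈ langOf P ↔ P n v := by
  have h := List.equivSigmaTuple.right_inv ⟨n, v⟩
  change (fun s : Σ n, Fin n → α => P s.1 s.2) (List.equivSigmaTuple (List.ofFn v)) ↔ _
  rw [show List.equivSigmaTuple (List.ofFn v) = ⟨n, v⟩ from h]

theorem ofFn_mem_map_langOf (f : α → β) {L : Language α} {n : ℕ} {v : Fin n → β} :
    List.ofFn v ∈ Language.map f L ↔ ∃ u : Fin n → α, f ∘ u = v ∧ List.ofFn u ∈ L := by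
  constructor
  · rintro ⟨w, hw, hwv⟩
    obtain ⟨⟨m, u⟩, rfl⟩ := List.equivSigmaTuple.symm.surjective w
    have hwv : List.map f (List.ofFn u) = List.ofFn v := hwv
    rw [List.map_ofFn] at hwv
    have hwv : List.equivSigmaTuple.symm ⟨m, f ∘ u⟩ = List.equivSigmaTuple.symm ⟨n, v⟩ := hwv
    cases List.equivSigmaTuple.symm.injective hwv
    exact ⟨u, rfl, hw⟩
  · rintro ⟨u, rfl, hu⟩
    exact ⟨_, hu, List.map_ofFn⟩

/-- A predicate on tuples that is inherited by subsequences defines a regular language. -/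
theorem isRegular_langOf_of_comp [Finite α] {P : ∀ n, (Fin n → α) → Prop}
    (h : ∀ m n (f : Fin m ↪o Fin n) (v : Fin n → α), P n v → P m (v ∘ f)) :
    (langOf P).IsRegular := by
  apply Language.isRegular_of_sublist_closed
  intro v w hvw hw
  obtain ⟨f, hf⟩ := List.sublist_iff_exists_fin_orderEmbedding_get_eq.1 hvw
  rw [mem_langOf, show v.get = w.get ∘ f from funext hf]
  exact h _ _ f _ hw

theorem mem_mul_singleton_mul {L₁ L₂ : Language α} {a : α} {w : List α} :
    w ∈ L₁ * {[a]} * L₂ ↔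
      ∃ i, ∃ hi : i < w.length, w[i] = a ∧ w.take i ∈ L₁ ∧ w.drop (i + 1) ∈ L₂ := by
  simp only [Language.mem_mul]
  constructor
  · rintro ⟨_, ⟨u, hu, _, rfl, rfl⟩, v, hv, rfl⟩
    exact ⟨u.length, by simp, by simp, by simpa using hu, by simpa using hv⟩
  · rintro ⟨i, hi, rfl, hu, hv⟩
    exact ⟨_, ⟨_, hu, _, rfl, rfl⟩, _, hv, by simp⟩

end LangOf

/-! ### Drawings and their encoding by words -/

section Encoding

variable {A : Type} (cx cy : A → ℕ)

/-- The order along one axis of points placed on consecutive lines `0, 1, 2, …`: the point at time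
`t` on the line `c` precedes the point at time `t'` on the line `c'`. Lines of odd index are
traversed forwards in time, those of even index backwards. -/
def Before {T : Type*} [LT T] (c : ℕ) (t : T) (c' : ℕ) (t' : T) : Prop :=
  c < c' ∨ c = c' ∧ if Even c then t' < t else t < t'

theorem before_congr {S T : Type*} [LT S] [LT T] {c c' : ℕ} {s s' : S} {t t' : T}
    (h : c = c' → (s < s' ↔ t < t')) (h' : c = c' → (s' < s ↔ t' < t)) :
    Before c s c' s' ↔ Before c t c' t' := by
  unfold Before
  refine or_congr_right (and_congr_right fun hc => ?_)
  rw [h hc, h' hc]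

/-- The permutation `p` is drawn with its `i`-th point, from the left, in the cell `g i` at time
`τ i`; the cell `a` is in the half column `cx a` and the half row `cy a`. -/
def IsDrawing {T : Type*} [LT T] {n : ℕ} (p : Equiv.Perm (Fin n)) (g : Fin n → A) (τ : Fin n → T) :
    Prop :=
  ∀ i j, (i < j ↔ Before (cx (g i)) (τ i) (cx (g j)) (τ j)) ∧
    (p i < p j ↔ Before (cy (g i)) (τ i) (cy (g j)) (τ j))

/-- The word `v` encodes the permutation `p`: the `k`-th letter of `v` is the cell of the point of
time `k`, and `τ i` is the time of the `i`-th point from the left. -/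
def Encodes {n : ℕ} (v : Fin n → A) (p τ : Equiv.Perm (Fin n)) : Prop :=
  IsDrawing cx cy p (v ∘ τ) τ

/-- An injective family is replaced by its ranks. -/
theorem exists_perm_lt_iff {T : Type*} [LinearOrder T] {n : ℕ} (f : Fin n → T)
    (hf : Function.Injective f) : ∃ ρ : Equiv.Perm (Fin n), ∀ i j, ρ i < ρ j ↔ f i < f j := by
  have hcard : (Finset.univ.image f).card = n := by
    rw [Finset.card_image_of_injective _ hf, Finset.card_fin]
  let o := (Finset.univ.image f).orderIsoOfFin hcard
  let g : Fin n → Fin n := fun i => o.symm ⟨f i, Finset.mem_image_of_mem f (Finset.mem_univ i)⟩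
  have hg : ∀ i j, g i < g j ↔ f i < f j := fun i j => o.symm.lt_iff_lt
  have hinj : Function.Injective g := fun i j hij =>
    hf (congrArg Subtype.val (o.symm.injective hij))
  exact ⟨Equiv.ofBijective g (Finite.injective_iff_bijective.1 hinj), hg⟩

theorem perm_eq_of_lt_iff {n : ℕ} {σ τ : Equiv.Perm (Fin n)}
    (h : ∀ i j, σ i < σ j ↔ τ i < τ j) : σ = τ := by
  have : StrictMono (σ.symm.trans τ) := fun i j hij => by
    simpa [← h] using hij
  have h1 : StrictMono.orderIsoOfSurjective _ this (Equiv.surjective _) = OrderIso.refl (Fin n) :=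
    Subsingleton.elim _ _
  ext i
  have := congrArg (fun o : Fin n ≃o Fin n => o (σ i)) h1
  simpa using (congrArg Fin.val this).symm

variable {cx cy}

theorem IsDrawing.exists_encodes {T : Type*} [LinearOrder T] {n : ℕ} {p : Equiv.Perm (Fin n)}
    {g : Fin n → A} {τ : Fin n → T} (h : IsDrawing cx cy p g τ) (hτ : Function.Injective τ) :
    ∃ (v : Fin n → A) (ρ : Equiv.Perm (Fin n)), Encodes cx cy v p ρ ∧ v ∘ ρ = g ∧
      ∀ i j, ρ i < ρ j ↔ τ i < τ j := by
  obtain ⟨ρ, hρ⟩ := exists_perm_lt_iff τ hτ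
  have hg : (g ∘ ρ.symm) ∘ ρ = g := by ext; simp
  refine ⟨g ∘ ρ.symm, ρ, ?_, hg, hρ⟩
  intro i j
  rw [hg, (h i j).1, (h i j).2]
  exact ⟨before_congr (fun _ => (hρ _ _).symm) fun _ => (hρ _ _).symm,
    before_congr (fun _ => (hρ _ _).symm) fun _ => (hρ _ _).symm⟩

/-- The defining property of an encoding, expressed in terms of times. -/
theorem Encodes.lt_symm {n : ℕ} {v : Fin n → A} {p τ : Equiv.Perm (Fin n)}
    (h : Encodes cx cy v p τ) (k l : Fin n) :
    (τ.symm k < τ.symm l ↔ Before (cx (v k)) k (cx (v l)) l) ∧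
    (p (τ.symm k) < p (τ.symm l) ↔ Before (cy (v k)) k (cy (v l)) l) := by
  have := h (τ.symm k) (τ.symm l)
  simpa using this

theorem Encodes.unique {n : ℕ} {v : Fin n → A} {p p' τ τ' : Equiv.Perm (Fin n)}
    (h : Encodes cx cy v p τ) (h' : Encodes cx cy v p' τ') : p = p' := by
  have hτ : τ.symm = τ'.symm := perm_eq_of_lt_iff fun k l => by
    rw [(h.lt_symm k l).1, (h'.lt_symm k l).1]
  have hτ : τ = τ' := Equiv.symm_bijective.injective hτ
  subst hτ
  exact perm_eq_of_lt_iff fun i j => by rw [(h i j).2, (h' i j).2]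

/-- The subwords of a word that encodes `p` encode permutations involved in `p`. -/
theorem Encodes.comp {m n : ℕ} {v : Fin n → A} {p τ : Equiv.Perm (Fin n)}
    (h : Encodes cx cy v p τ) (f : Fin m ↪o Fin n) :
    ∃ p' τ' : Equiv.Perm (Fin m), Encodes cx cy (v ∘ f) p' τ' ∧ Involved ⟨m, p'⟩ ⟨n, p⟩ := by
  obtain ⟨ρ, hρ⟩ := exists_perm_lt_iff (τ.symm ∘ f) (τ.symm.injective.comp f.injective)
  obtain ⟨ρ', hρ'⟩ := exists_perm_lt_iff (p ∘ τ.symm ∘ f)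
    (p.injective.comp (τ.symm.injective.comp f.injective))
  have key : ∀ k l, (ρ k < ρ l ↔ Before (cx (v (f k))) k (cx (v (f l))) l) ∧
      (ρ' k < ρ' l ↔ Before (cy (v (f k))) k (cy (v (f l))) l) := by
    intro k l
    rw [hρ, hρ']
    simp only [Function.comp_apply, (h.lt_symm (f k) (f l)).1, (h.lt_symm (f k) (f l)).2]
    exact ⟨before_congr (fun _ => f.lt_iff_lt) fun _ => f.lt_iff_lt,
      before_congr (fun _ => f.lt_iff_lt) fun _ => f.lt_iff_lt⟩
  refine ⟨ρ.symm.trans ρ', ρ.symm, ?_, fun i => τ.symm (f (ρ.symm i)), ?_, ?_⟩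
  · intro i j
    simpa using key (ρ.symm i) (ρ.symm j)
  · intro i j hij
    have := hρ (ρ.symm i) (ρ.symm j)
    simpa [hij] using this
  · intro i j
    simpa using hρ' (ρ.symm i) (ρ.symm j)

end Encoding

/-! ### The conditions that single out one word for each permutation -/

section Canonical

variable {A : Type} (cx cy : A → ℕ)

/-- The word `v` encodes a member of `C`. -/
def EncodesMem (C : Set Permutation) (n : ℕ) (v : Fin n → A) : Prop :=
  ∃ p τ, (⟨n, p⟩ : Permutation) ∈ C ∧ Encodes cx cy v p τ

/-- In the drawing encoded by the first components of `f`, moving each point to the cell given by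
the second component of its letter yields a drawing of the same permutation, with suitable new
times `σ`. -/
def IsRedrawing (n : ℕ) (f : Fin n → A × A) : Prop :=
  ∃ σ : Fin n → ℕ, Function.Injective σ ∧ ∀ k l,
    (Before (cx (f k).1) k (cx (f l).1) l ↔
      Before (cx (f k).2) (σ k) (cx (f l).2) (σ l)) ∧
    (Before (cy (f k).1) k (cy (f l).1) l ↔
      Before (cy (f k).2) (σ k) (cy (f l).2) (σ l))

/-- Letters whose cells share neither half column nor half row: they may be exchanged when adjacent
in a word. -/
def CellsCommute (a b : A) : Prop := cx a ≠ cx b ∧ cy a ≠ cy b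

theorem isRegular_encodesMem [Finite A] {C : Set Permutation} (hC : IsPermClass C) :
    (langOf (EncodesMem cx cy C)).IsRegular := by
  refine isRegular_langOf_of_comp fun m n f v ⟨p, τ, hp, h⟩ => ?_
  obtain ⟨p', τ', h', hinv⟩ := h.comp f
  exact ⟨p', τ', hC _ _ hp hinv, h'⟩

theorem isRegular_isRedrawing [Finite A] : (langOf (IsRedrawing cx cy)).IsRegular := by
  refine isRegular_langOf_of_comp fun m n f v ⟨σ, hσ, h⟩ => ?_
  refine ⟨σ ∘ f, hσ.comp f.injective, fun k l => ?_⟩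
  have := h (f k) (f l)
  constructor
  · exact (before_congr (fun _ => f.lt_iff_lt.symm) fun _ => f.lt_iff_lt.symm).trans this.1
  · exact (before_congr (fun _ => f.lt_iff_lt.symm) fun _ => f.lt_iff_lt.symm).trans this.2

variable [LinearOrder A]

/-- In the drawing encoded by the first components of `f`, the leftmost point at which the two
components differ has the smaller cell as its second component. -/
def IsDecrease (n : ℕ) (f : Fin n → A × A) : Prop :=
  ∃ k, (f k).2 < (f k).1 ∧ ∀ l, Before (cx (f l).1) l (cx (f k).1) k → (f l).1 = (f l).2

/-- Some letter commutes with a factor of `v` directly before it, and is smaller than the first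
letter of that factor. -/
def HasDescent (n : ℕ) (v : Fin n → A) : Prop :=
  ∃ i j, i < j ∧ v j < v i ∧ ∀ l, i ≤ l → l < j → CellsCommute cx cy (v l) (v j)

/-- Among the words encoding a given member of `C`, the one chosen to represent it. -/
def IsCanonical (C : Set Permutation) (n : ℕ) (v : Fin n → A) : Prop :=
  EncodesMem cx cy C n v ∧
    (¬ ∃ f : Fin n → A × A, Prod.fst ∘ f = v ∧ IsRedrawing cx cy n f ∧ IsDecrease cx n f) ∧
    ¬ HasDescent cx cy n v

/-- Whether another point lies to the left of the point `k` depends only on the two letters and on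
which comes first, so the condition restricts the letters before `k` and those after `k` to two
fixed sets. -/
theorem isRegular_isDecrease [Finite A] : (langOf (IsDecrease cx)).IsRegular := by
  have : langOf (IsDecrease cx) = {w | ∃ q : {q : A × A // q.2 < q.1}, w ∈
      Language.wordsOver {r : A × A | Before (cx r.1) 0 (cx q.1.1) 1 → r.1 = r.2} * {[q.1]} *
      Language.wordsOver {r : A × A | Before (cx r.1) 1 (cx q.1.1) 0 → r.1 = r.2}} := by
    ext w
    change (∃ k, _) ↔ ∃ q : {q : A × A // q.2 < q.1}, _
    constructor
    · rintro ⟨k, hk, h⟩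
      refine ⟨⟨w.get k, hk⟩, mem_mul_singleton_mul.2 ⟨k, k.2, rfl, ?_, ?_⟩⟩
      · intro r hr hb
        obtain ⟨l, hl, rfl⟩ := List.mem_iff_getElem.1 hr
        rw [List.length_take, lt_min_iff] at hl
        rw [List.getElem_take] at hb ⊢
        refine h ⟨l, hl.2⟩ ((before_congr (fun _ => ?_) fun _ => ?_).1 hb)
        · simpa [Fin.lt_def] using hl.1
        · simpa [Fin.le_def] using hl.1.le
      · intro r hr hb
        obtain ⟨l, hl, rfl⟩ := List.mem_iff_getElem.1 hr
        rw [List.length_drop] at hl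
        rw [List.getElem_drop] at hb ⊢
        refine h ⟨k + 1 + l, by omega⟩ ((before_congr (fun _ => ?_) fun _ => ?_).1 hb)
        · simp [Fin.le_def]; omega
        · simp [Fin.lt_def]; omega
    · rintro ⟨⟨q, hq⟩, hw⟩
      obtain ⟨k, hk, rfl, h₁, h₂⟩ := mem_mul_singleton_mul.1 hw
      refine ⟨⟨k, hk⟩, hq, fun l hb => ?_⟩
      rcases lt_trichotomy l.1 k with hl | hl | hl
      · refine h₁ _ (List.mem_iff_getElem.2 ⟨l, by simp; omega, List.getElem_take⟩)
          ((before_congr (fun _ => ?_) fun _ => ?_).1 hb)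
        · simpa [Fin.lt_def] using hl
        · simpa [Fin.le_def] using hl.le
      · obtain rfl : l = ⟨k, hk⟩ := Fin.ext hl
        simp [Before] at hb
      · refine h₂ _ (List.mem_iff_getElem.2 ⟨l - (k + 1), by simp; omega, ?_⟩)
          ((before_congr (fun _ => ?_) fun _ => ?_).1 hb)
        · simp [List.getElem_drop, Nat.add_sub_cancel' (Nat.succ_le_of_lt hl)]
        · simpa [Fin.le_def] using hl.le
        · simpa [Fin.lt_def] using hl
  rw [this]
  exact Language.IsRegular.iUnion fun q => ((Language.isRegular_wordsOver _).mul
    (Language.isRegular_singleton _)).mul (Language.isRegular_wordsOver _)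

theorem isRegular_hasDescent [Finite A] : (langOf (HasDescent cx cy)).IsRegular := by
  have : langOf (HasDescent cx cy) =
      {w | ∃ q : {q : A × A // q.2 < q.1 ∧ CellsCommute cx cy q.1 q.2}, w ∈
        Language.wordsOver Set.univ * {[q.1.1]} * Language.wordsOver {c | CellsCommute cx cy c q.1.2} *
          {[q.1.2]} * Language.wordsOver Set.univ} := by
    ext w
    change (∃ i j, _) ↔ ∃ q : {q : A × A // q.2 < q.1 ∧ CellsCommute cx cy q.1 q.2}, _
    constructor
    · rintro ⟨i, j, hij, hlt, h⟩
      have hij' : i.1 < j.1 := hij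
      refine ⟨⟨(w.get i, w.get j), hlt, h i le_rfl hij⟩,
        mem_mul_singleton_mul.2 ⟨j, j.2, rfl, mem_mul_singleton_mul.2
          ⟨i, by simp; omega, List.getElem_take, fun _ _ => trivial, ?_⟩, fun _ _ => trivial⟩⟩
      intro c hc
      obtain ⟨l, hl, rfl⟩ := List.mem_iff_getElem.1 hc
      rw [List.length_drop, List.length_take] at hl
      rw [List.getElem_drop, List.getElem_take]
      exact h ⟨i + 1 + l, by omega⟩ (by simp [Fin.le_def]; omega) (by simp [Fin.lt_def]; omega)
    · rintro ⟨⟨⟨a, b⟩, hlt, hab⟩, hw⟩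
      obtain ⟨j, hj, rfl, hw, -⟩ := mem_mul_singleton_mul.1 hw
      obtain ⟨i, hi, rfl, -, h⟩ := mem_mul_singleton_mul.1 hw
      rw [List.length_take, lt_min_iff] at hi
      simp only [List.getElem_take] at hlt hab
      refine ⟨⟨i, hi.2⟩, ⟨j, hj⟩, hi.1, hlt, fun l hil hlj => ?_⟩
      have hil' : i ≤ l := hil
      have hlj' : l < j := hlj
      rcases hil'.eq_or_lt with rfl | hil'
      · exact hab
      · refine h _ (List.mem_iff_getElem.2 ⟨l - (i + 1), by simp; omega, ?_⟩)
        simp [List.getElem_drop, Nat.add_sub_cancel' (Nat.succ_le_of_lt hil')]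
  rw [this]
  exact Language.IsRegular.iUnion fun q => ((((Language.isRegular_wordsOver _).mul
    (Language.isRegular_singleton _)).mul (Language.isRegular_wordsOver _)).mul
    (Language.isRegular_singleton _)).mul (Language.isRegular_wordsOver _)

theorem isRegular_isCanonical [Finite A] {C : Set Permutation} (hC : IsPermClass C) :
    (langOf (IsCanonical cx cy C)).IsRegular := by
  have : langOf (IsCanonical cx cy C) = langOf (EncodesMem cx cy C) ⊓
      (Language.map Prod.fst (langOf (IsRedrawing cx cy) ⊓ langOf (IsDecrease cx)))ᶜ ⊓
      (langOf (HasDescent cx cy))ᶜ := by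
    ext w
    obtain ⟨⟨n, v⟩, rfl⟩ := List.equivSigmaTuple.symm.surjective w
    have hsplit : ∀ (L₁ L₂ L₃ : Language A) (w : List A),
        w ∈ L₁ ⊓ L₂ᶜ ⊓ L₃ᶜ ↔ (w ∈ L₁ ∧ ¬ w ∈ L₂) ∧ ¬ w ∈ L₃ := fun _ _ _ _ => Iff.rfl
    rw [hsplit]
    change List.ofFn v ∈ langOf (IsCanonical cx cy C) ↔ (List.ofFn v ∈ langOf _ ∧
      ¬ List.ofFn v ∈ Language.map _ _) ∧ ¬ List.ofFn v ∈ langOf _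
    rw [ofFn_mem_langOf, ofFn_mem_langOf, ofFn_mem_langOf, ofFn_mem_map_langOf, and_assoc]
    have : ∀ u : Fin n → A × A, List.ofFn u ∈ langOf (IsRedrawing cx cy) ⊓ langOf (IsDecrease cx) ↔
        IsRedrawing cx cy n u ∧ IsDecrease cx n u := fun u =>
      and_congr ofFn_mem_langOf ofFn_mem_langOf
    simp only [this]
    rfl
  rw [this]
  exact ((isRegular_encodesMem cx cy hC).inf
    (((isRegular_isRedrawing cx cy).inf (isRegular_isDecrease cx)).map _).compl).inf
    (isRegular_hasDescent cx cy).compl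

end Canonical

/-! ### Each permutation has exactly one canonical word -/

section Choice

variable {A : Type} {cx cy : A → ℕ}

theorem Before.lt_iff {T : Type*} [LT T] {c : ℕ} {s t : T} :
    Before c s c t ↔ if Even c then t < s else s < t := by
  simp [Before]

/-- A permutation `r` fixes everything below `i` if, whenever `r b = k` with `k < i` and `k < b`, it
preserves the order of `k` and `b`. -/
theorem perm_apply_eq_of_lt {n : ℕ} {r : Equiv.Perm (Fin n)} {i : Fin n}
    (h : ∀ k < i, ∀ b, k < b → r b = k → r k < r b) : ∀ k < i, r k = k := by
  intro k
  induction k using WellFoundedLT.induction with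
  | ind k ih =>
    intro hk
    have hb : r (r.symm k) = k := r.apply_symm_apply k
    rcases lt_trichotomy (r.symm k) k with hlt | heq | hgt
    · exact absurd ((ih _ hlt (hlt.trans hk)).symm.trans hb) hlt.ne
    · rwa [heq] at hb
    · have hlt := h k hk _ hgt hb
      rw [hb] at hlt
      exact absurd (r.injective (ih _ hlt (hlt.trans hk))) hlt.ne

/-- If two words encode the same permutation with the same cells, then passing from the times of
the first to those of the second preserves the order of letters that do not commute. -/
theorem Encodes.lt_of_not_cellsCommute {n : ℕ} {v v' : Fin n → A} {p τ τ' : Equiv.Perm (Fin n)}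
    (h : Encodes cx cy v p τ) (h' : Encodes cx cy v' p τ') (hg : v' ∘ τ' = v ∘ τ)
    {k l : Fin n} (hkl : k < l) (hc : ¬ CellsCommute cx cy (v' k) (v' l)) :
    τ (τ'.symm k) < τ (τ'.symm l) := by
  have hv : ∀ k, v (τ (τ'.symm k)) = v' k := fun k => by
    simpa using (congrFun hg (τ'.symm k)).symm
  rw [CellsCommute, not_and_or, not_not, not_not] at hc
  have H := fun a b => (h' (τ'.symm a) (τ'.symm b)).1.symm.trans (h (τ'.symm a) (τ'.symm b)).1
  have H' := fun a b => (h' (τ'.symm a) (τ'.symm b)).2.symm.trans (h (τ'.symm a) (τ'.symm b)).2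
  simp only [Function.comp_apply, Equiv.apply_symm_apply, hv] at H H'
  rcases hc with hc | hc
  · by_cases he : Even (cx (v' k))
    · simpa [hc, Before.lt_iff, hc ▸ he, hkl] using H l k
    · simpa [hc, Before.lt_iff, hc ▸ he, hkl] using H k l
  · by_cases he : Even (cy (v' k))
    · simpa [hc, Before.lt_iff, hc ▸ he, hkl] using H' l k
    · simpa [hc, Before.lt_iff, hc ▸ he, hkl] using H' k l

variable [LinearOrder A]

/-- If the word `v` is not lexicographically least among the words that encode the same permutation
with the same cells, then it has a descent: where a smaller word `v'` first differs from `v`, the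
letter of `v'` occurs later in `v`, and it has to commute with everything it overtakes. -/
theorem Encodes.hasDescent_of_lt {n : ℕ} {v v' : Fin n → A} {p τ τ' : Equiv.Perm (Fin n)}
    (h : Encodes cx cy v p τ) (h' : Encodes cx cy v' p τ') (hg : v' ∘ τ' = v ∘ τ)
    (hlt : toLex v' < toLex v) : HasDescent cx cy n v := by
  obtain ⟨i, hpre, hi⟩ := hlt
  simp only [Pi.toLex_apply] at hpre hi
  let r : Equiv.Perm (Fin n) := τ'.symm.trans τ
  have hv : ∀ k, v (r k) = v' k := fun k => by
    simpa [r] using (congrFun hg (τ'.symm k)).symm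
  have hr : ∀ {k l}, k < l → ¬ CellsCommute cx cy (v' k) (v' l) → r k < r l := fun hkl hc =>
    h.lt_of_not_cellsCommute h' hg hkl hc
  have hfix : ∀ k < i, r k = k := perm_apply_eq_of_lt fun k hk b hkb hb => by
    refine hr hkb fun hc => hc.1 ?_
    rw [← hv b, hb, hpre k hk]
  -- the letters before `i` are fixed, so `r` and its inverse preserve the positions from `i` on
  have hge : ∀ k, i ≤ r k → i ≤ k := fun k hk => by
    by_contra! hlt
    exact absurd hlt (not_lt.2 (hfix k hlt ▸ hk))
  have hri : i < r i := by
    refine lt_of_le_of_ne ?_ fun heq => ?_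
    · by_contra! hlt
      exact absurd (r.injective (hfix _ hlt)) hlt.ne
    · have := hv i
      rw [← heq] at this
      exact hi.ne this.symm
  refine ⟨i, r i, hri, by rwa [hv], fun l hil hli => ?_⟩
  by_contra hc
  obtain ⟨m, rfl⟩ := r.surjective l
  have him : i < m := lt_of_le_of_ne (hge m hil) fun heq => hli.ne (heq ▸ rfl)
  rw [hv, hv] at hc
  exact absurd (hr him fun hc' => hc ⟨hc'.1.symm, hc'.2.symm⟩) hli.not_gt

/-- A word with a descent is not lexicographically least among those encoding the same permutation
with the same cells: the smaller letter may be moved in front of the factor. -/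
theorem Encodes.exists_lt_of_hasDescent {n : ℕ} {v : Fin n → A} {p τ : Equiv.Perm (Fin n)}
    (h : Encodes cx cy v p τ) (hd : HasDescent cx cy n v) :
    ∃ v' τ', Encodes cx cy v' p τ' ∧ v' ∘ τ' = v ∘ τ ∧ toLex v' < toLex v := by
  obtain ⟨i, j, hij, hlt, hc⟩ := hd
  -- new times at which the letter at `j` comes directly before the letter at `i`
  let t : Fin n → ℕ := fun l => if l = j then 2 * i else 2 * l + 1
  have htj : t j = 2 * i := if_pos rfl
  have ht : ∀ l, l ≠ j → t l = 2 * l + 1 := fun l hl => if_neg hl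
  have ht_inj : Function.Injective t := by
    intro a b hab
    by_cases ha : a = j <;> by_cases hb : b = j
    · rw [ha, hb]
    · rw [ha, htj, ht b hb] at hab; omega
    · rw [hb, htj, ht a ha] at hab; omega
    · rw [ht a ha, ht b hb] at hab; exact Fin.ext (by omega)
  have hcomm : ∀ a b, ¬ CellsCommute cx cy (v a) (v b) → (a < b ↔ t a < t b) := by
    intro a b hab
    by_cases ha : a = j <;> by_cases hb : b = j
    · rw [ha, hb]; simp
    · subst ha
      have : ¬ (i ≤ b ∧ b < a) := fun hb' =>
        hab ⟨(hc b hb'.1 hb'.2).1.symm, (hc b hb'.1 hb'.2).2.symm⟩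
      rw [htj, ht b hb]
      simp only [Fin.lt_def, Fin.le_def, Fin.ext_iff] at *
      omega
    · subst hb
      have : ¬ (i ≤ a ∧ a < b) := fun ha' => hab (hc a ha'.1 ha'.2)
      rw [htj, ht a ha]
      simp only [Fin.lt_def, Fin.le_def, Fin.ext_iff] at *
      omega
    · rw [ht a ha, ht b hb, Fin.lt_def]; omega
  have hdraw : IsDrawing cx cy p (v ∘ τ) (t ∘ τ) := by
    intro a b
    rw [(h a b).1, (h a b).2]
    exact ⟨before_congr (fun e => hcomm _ _ fun hc => hc.1 e)
        fun e => hcomm _ _ fun hc => hc.1 e.symm,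
      before_congr (fun e => hcomm _ _ fun hc => hc.2 e)
        fun e => hcomm _ _ fun hc => hc.2 e.symm⟩
  obtain ⟨v', ρ, h', hg, hρ⟩ := hdraw.exists_encodes (ht_inj.comp τ.injective)
  refine ⟨v', ρ, h', hg, ?_⟩
  let r : Equiv.Perm (Fin n) := τ.symm.trans ρ
  have hr : ∀ a b, r a < r b ↔ t a < t b := fun a b => by simp [r, hρ]
  have hv : ∀ k, v' (r k) = v k := fun k => by simpa [r] using congrFun hg (τ.symm k)
  have hfix : ∀ k < i, r k = k := perm_apply_eq_of_lt fun k hk b hkb _ => by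
    rw [hr, ht k (hk.trans hij).ne]
    by_cases hb : b = j
    · rw [hb, htj]; rw [Fin.lt_def] at hk; omega
    · rw [ht b hb]; rw [Fin.lt_def] at hkb; omega
  have hrj : r j = i := by
    obtain ⟨b, hb⟩ := r.surjective i
    by_cases hbj : b = j
    · rw [← hbj, hb]
    · have hib : i ≤ b := by
        by_contra! hlt
        exact hlt.ne ((hfix b hlt).symm.trans hb)
      have : r j < i := by
        rw [← hb, hr, htj, ht b hbj]
        rw [Fin.le_def] at hib
        omega
      exact absurd (r.injective (hfix _ this)) (this.trans hij).ne
  refine ⟨i, fun k hk => ?_, ?_⟩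
  · simpa [hfix k hk] using hv k
  · simpa [← hrj, hv] using hlt

/-- Two encodings of a permutation whose cells, read from left to right, differ give a decreasing
redrawing of the one with the larger sequence of cells. -/
theorem Encodes.exists_isDecrease_of_lt {n : ℕ} {v v' : Fin n → A} {p τ τ' : Equiv.Perm (Fin n)}
    (h : Encodes cx cy v p τ) (h' : Encodes cx cy v' p τ') (hlt : toLex (v' ∘ τ') < toLex (v ∘ τ)) :
    ∃ f : Fin n → A × A, Prod.fst ∘ f = v ∧ IsRedrawing cx cy n f ∧ IsDecrease cx n f := by
  obtain ⟨i, hpre, hi⟩ := hlt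
  simp only [Pi.toLex_apply, Function.comp_apply] at hpre hi
  refine ⟨fun k => (v k, v' (τ' (τ.symm k))), rfl, ⟨fun k => τ' (τ.symm k), ?_, fun k l => ?_⟩,
    τ i, by simpa using hi, fun l hl => ?_⟩
  · exact Fin.val_injective.comp (τ'.injective.comp τ.symm.injective)
  · have hx := (h.lt_symm k l).1.symm.trans (h' (τ.symm k) (τ.symm l)).1
    have hy := (h.lt_symm k l).2.symm.trans (h' (τ.symm k) (τ.symm l)).2
    exact ⟨hx, hy⟩
  · have : τ.symm l < τ.symm (τ i) := (h.lt_symm l (τ i)).1.2 hl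
    rw [Equiv.symm_apply_apply] at this
    simpa using (hpre _ this).symm

/-- A decreasing redrawing of an encoded permutation has a smaller sequence of cells. -/
theorem Encodes.exists_lt_of_isDecrease {n : ℕ} {f : Fin n → A × A} {p τ : Equiv.Perm (Fin n)}
    (h : Encodes cx cy (Prod.fst ∘ f) p τ) (hf : IsRedrawing cx cy n f) (hd : IsDecrease cx n f) :
    ∃ v' τ', Encodes cx cy v' p τ' ∧ toLex (v' ∘ τ') < toLex ((Prod.fst ∘ f) ∘ τ) := by
  obtain ⟨σ, hσ, hf⟩ := hf
  obtain ⟨k, hk, hd⟩ := hd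
  have hdraw : IsDrawing cx cy p (fun i => (f (τ i)).2) (σ ∘ τ) := by
    intro i j
    rw [(h i j).1, (h i j).2]
    exact hf (τ i) (τ j)
  obtain ⟨v', ρ, h', hg, -⟩ := hdraw.exists_encodes (hσ.comp τ.injective)
  refine ⟨v', ρ, h', τ.symm k, fun i hi => ?_, ?_⟩
  · rw [hg]
    refine (hd (τ i) ?_).symm
    have := (h.lt_symm (τ i) k).1.1 (by simpa using hi)
    exact this
  · rw [hg]
    simpa using hk

/-- Every permutation that is encoded by a word is encoded by a canonical one: take the word with
the least sequence of cells, and among the words with this sequence the least one. -/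
theorem exists_isCanonical [Finite A] {C : Set Permutation} {n : ℕ} {p : Equiv.Perm (Fin n)}
    (hp : (⟨n, p⟩ : Permutation) ∈ C) (h : ∃ v τ, Encodes cx cy v p τ) :
    ∃ v τ, IsCanonical cx cy C n v ∧ Encodes cx cy v p τ := by
  have : Finite (Lex (Fin n → A)) := inferInstanceAs (Finite (Fin n → A))
  have hwf : WellFounded ((· < ·) : Lex (Fin n → A) → Lex (Fin n → A) → Prop) := wellFounded_lt
  obtain ⟨g, ⟨v₀, τ₀, h₀, hg₀⟩, hmin⟩ := hwf.has_min
    {g | ∃ v τ, Encodes cx cy v p τ ∧ toLex (v ∘ τ) = g}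
    (by obtain ⟨v, τ, h⟩ := h; exact ⟨_, v, τ, h, rfl⟩)
  obtain ⟨w, ⟨v, τ, h, hg, rfl⟩, hmin'⟩ := hwf.has_min
    {w | ∃ v τ, Encodes cx cy v p τ ∧ toLex (v ∘ τ) = g ∧ toLex v = w}
    ⟨_, v₀, τ₀, h₀, hg₀, rfl⟩
  refine ⟨v, τ, ⟨⟨p, τ, hp, h⟩, ?_, fun hd => ?_⟩, h⟩
  · rintro ⟨f, rfl, hf, hd⟩
    obtain ⟨v', τ', h', hlt⟩ := h.exists_lt_of_isDecrease hf hd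
    exact hmin _ ⟨v', τ', h', rfl⟩ (hg ▸ hlt)
  · obtain ⟨v', τ', h', hg', hlt⟩ := h.exists_lt_of_hasDescent hd
    exact hmin' _ ⟨v', τ', h', by rw [hg', hg], rfl⟩ hlt

theorem IsCanonical.unique {C : Set Permutation} {n : ℕ} {v v' : Fin n → A}
    {p τ τ' : Equiv.Perm (Fin n)} (hv : IsCanonical cx cy C n v) (hv' : IsCanonical cx cy C n v')
    (h : Encodes cx cy v p τ) (h' : Encodes cx cy v' p τ') : v = v' := by
  have hg : toLex (v ∘ τ) = toLex (v' ∘ τ') := le_antisymm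
    (not_lt.1 fun hlt => hv.2.1 (h.exists_isDecrease_of_lt h' hlt))
    (not_lt.1 fun hlt => hv'.2.1 (h'.exists_isDecrease_of_lt h hlt))
  have hg : v ∘ τ = v' ∘ τ' := toLex.injective hg
  exact toLex.injective (le_antisymm
    (not_lt.1 fun hlt => hv.2.2 (h.hasDescent_of_lt h' hg.symm hlt))
    (not_lt.1 fun hlt => hv'.2.2 (h'.hasDescent_of_lt h hg hlt)))

/-- If every member of a permutation class is encoded by a word, then the canonical words form a
regular language in length-preserving bijection with the class. -/
theorem exists_isRegular_equiv [Finite A] {C : Set Permutation} (hC : IsPermClass C)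
    (henc : ∀ n (p : Equiv.Perm (Fin n)), (⟨n, p⟩ : Permutation) ∈ C →
      ∃ v τ, Encodes cx cy v p τ) :
    ∃ L : Language A, L.IsRegular ∧ ∃ e : {π : Permutation // π ∈ C} ≃ {w : List A // w ∈ L},
      ∀ π, (e π).1.length = π.1.length := by
  refine ⟨_, isRegular_isCanonical cx cy hC, ?_⟩
  choose v τ hv h using fun π : {π : Permutation // π ∈ C} =>
    exists_isCanonical π.2 (henc π.1.1 π.1.2 π.2)
  let e : {π : Permutation // π ∈ C} → {w : List A // w ∈ langOf (IsCanonical cx cy C)} :=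
    fun π => ⟨List.ofFn (v π), ofFn_mem_langOf.2 (hv π)⟩
  refine ⟨Equiv.ofBijective e ⟨fun π π' heq => ?_, fun w => ?_⟩, fun π => ?_⟩
  · have heq : List.equivSigmaTuple.symm ⟨π.1.1, v π⟩ = List.equivSigmaTuple.symm ⟨π'.1.1, v π'⟩ :=
      congrArg Subtype.val heq
    have heq := List.equivSigmaTuple.symm.injective heq
    obtain ⟨⟨n, p⟩, hp⟩ := π
    obtain ⟨⟨n', p'⟩, hp'⟩ := π'
    have hn : n = n' := congrArg Sigma.fst heq
    subst hn
    have hvv : v ⟨⟨n, p⟩, hp⟩ = v ⟨⟨n, p'⟩, hp'⟩ := eq_of_heq (Sigma.mk.inj heq).2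
    have h' := h ⟨⟨n, p'⟩, hp'⟩
    rw [← hvv] at h'
    have hpp : p = p' := (h ⟨⟨n, p⟩, hp⟩).unique h'
    subst hpp
    rfl
  · obtain ⟨w, hw⟩ := w
    have hw' : IsCanonical cx cy C w.length w.get := hw
    obtain ⟨p, ρ, hp, hρ⟩ := hw'.1
    refine ⟨⟨⟨_, p⟩, hp⟩, Subtype.ext ?_⟩
    have := (hv ⟨⟨_, p⟩, hp⟩).unique hw' (h ⟨⟨_, p⟩, hp⟩) hρ
    change List.ofFn (v ⟨⟨_, p⟩, hp⟩) = w
    rw [this]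
    exact List.ofFn_get w
  · exact List.length_ofFn

end Choice

/-! ### Points of the standard figure as cells and times -/

section Figure

variable {t u : ℕ}

/-- The half cells of a `t × u` matrix: `(k, l, s)` stands for the right half (`s = true`) or the
left half of the cell in column `k` and row `l`. -/
abbrev HalfCell (t u : ℕ) : Type := Fin t ×ₗ (Fin u ×ₗ Bool)

/-- The half column of a half cell. -/
def halfCol (a : HalfCell t u) : ℕ := 2 * (ofLex a).1 + (ofLex (ofLex a).2).2.toNat

/-- The half row met by the segment of the standard figure of `M` in a half cell. -/
def halfRow (M : Matrix (Fin t) (Fin u) SignType) (a : HalfCell t u) : ℕ :=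
  2 * (ofLex (ofLex a).2).1 +
    (if M (ofLex a).1 (ofLex (ofLex a).2).1 = 1 then (ofLex (ofLex a).2).2
      else !(ofLex (ofLex a).2).2).toNat

/-- The coordinate of a point in the `c`-th half column (or half row) at distance `d` from the
centre of the column (or row). -/
noncomputable def coord (c : ℕ) (d : ℝ) : ℝ := if Even c then (c + 1) / 2 - d else c / 2 + d

theorem coord_lt_coord {c c' : ℕ} {d d' : ℝ} (hd : 0 ≤ d) (hd2 : d < 1 / 2) (hd' : 0 ≤ d')
    (hd2' : d' < 1 / 2) (hc : c < c') (hne : coord c d ≠ coord c' d') :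
    coord c d < coord c' d' := by
  have hc' : (c : ℝ) + 1 ≤ c' := by exact_mod_cast hc
  refine lt_of_le_of_ne ?_ hne
  unfold coord
  split_ifs <;> linarith

theorem coord_lt_coord_iff {T : Type*} [Preorder T] {c c' : ℕ} {d d' : ℝ} {s s' : T} (hd : 0 ≤ d)
    (hd2 : d < 1 / 2) (hd' : 0 ≤ d') (hd2' : d' < 1 / 2) (hne : coord c d ≠ coord c' d')
    (hs : d < d' → s < s') (hs' : d' < d → s' < s) :
    coord c d < coord c' d' ↔ Before c s c' s' := by
  rcases lt_trichotomy c c' with hc | rfl | hc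
  · exact iff_of_true (coord_lt_coord hd hd2 hd' hd2' hc hne) (Or.inl hc)
  · rw [Before.lt_iff]
    unfold coord at *
    rcases lt_trichotomy d d' with h | rfl | h
    · have h₁ := hs h
      split_ifs
      · exact iff_of_false (by linarith) h₁.not_gt
      · exact iff_of_true (by linarith) h₁
    · exact absurd rfl hne
    · have h₁ := hs' h
      split_ifs
      · exact iff_of_true (by linarith) h₁
      · exact iff_of_false (by linarith) h₁.not_gt
  · refine iff_of_false (coord_lt_coord hd' hd2' hd hd2 hc hne.symm).not_gt ?_
    rintro (h | ⟨h, -⟩) <;> omega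

/-- The point at position `x` of the unit interval that starts at `k` lies in a half of it, at
distance `|x - 1/2|` from its centre; the centre itself is counted to the right half. -/
theorem coord_two_mul_add (k : ℕ) (x : ℝ) :
    (k : ℝ) + x = coord (2 * k + (decide (1 / 2 ≤ x)).toNat) |x - 1 / 2| := by
  unfold coord
  by_cases h : 1 / 2 ≤ x
  · rw [abs_of_nonneg (by linarith), decide_eq_true h]
    simp
    ring
  · rw [abs_of_nonpos (by linarith), decide_eq_false h]
    simp
    ring

theorem coord_two_mul_add_one_sub (k : ℕ) (x : ℝ) :
    (k : ℝ) + 1 - x = coord (2 * k + (!decide (1 / 2 ≤ x)).toNat) |x - 1 / 2| := by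
  unfold coord
  by_cases h : 1 / 2 ≤ x
  · rw [abs_of_nonneg (by linarith), decide_eq_true h]
    simp
    ring
  · rw [abs_of_nonpos (by linarith), decide_eq_false h]
    simp
    ring

/-- Each point of the standard figure is determined by a half cell and its distance from the centre
lines of its column and row, which are the same since the segments have slope `±1`. -/
theorem exists_halfCell {M : Matrix (Fin t) (Fin u) SignType} {q : ℝ × ℝ}
    (hq : q ∈ standardFigure M) :
    ∃ (a : HalfCell t u) (d : ℝ), 0 ≤ d ∧ d < 1 / 2 ∧
      q.1 = coord (halfCol a) d ∧ q.2 = coord (halfRow M a) d := by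
  obtain ⟨k, l, ⟨hM, hq⟩ | ⟨hM, hq⟩⟩ := hq <;>
  · rw [openSegment_eq_image'] at hq
    obtain ⟨θ, ⟨h0, h1⟩, rfl⟩ := hq
    refine ⟨toLex (k, toLex (l, decide (1 / 2 ≤ θ))), |θ - 1 / 2|, abs_nonneg _,
      abs_lt.2 ⟨by linarith, by linarith⟩, ?_, ?_⟩
    · rw [halfCol, ofLex_toLex, ofLex_toLex, ← coord_two_mul_add]
      simp
    · simp only [halfRow, ofLex_toLex, hM, if_true, if_neg (show (-1 : SignType) ≠ 1 by decide)]
      first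
        | rw [← coord_two_mul_add]; simp
        | rw [← coord_two_mul_add_one_sub]; simp; ring

theorem exists_encodes_of_mem_geom {M : Matrix (Fin t) (Fin u) SignType} {n : ℕ}
    {p : Equiv.Perm (Fin n)} (hp : (⟨n, p⟩ : Permutation) ∈ Geom M) :
    ∃ v τ, Encodes halfCol (halfRow M) v p τ := by
  obtain ⟨q, hqF, hqx, hqy⟩ := hp
  choose a d h0 h1 hx hy using fun i => exists_halfCell (hqF i)
  -- two points in one half column or half row have different distances, so that ties may be broken
  -- arbitrarily
  let τ : Fin n → ℝ ×ₗ Fin n := fun i => toLex (d i, i)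
  have hτ : Function.Injective τ := fun i j hij => congrArg (fun x => (ofLex x).2) hij
  have hτd : ∀ i j, d i < d j → τ i < τ j := fun i j hij => Prod.Lex.toLex_lt_toLex.2 (Or.inl hij)
  have hdraw : IsDrawing halfCol (halfRow M) p a τ := by
    intro i j
    rcases eq_or_ne i j with rfl | hij
    · simp [Before]
    · rw [← hqx.lt_iff_lt, hqy i j]
      have hxne : (q i).1 ≠ (q j).1 := hqx.injective.ne hij
      have hyne : (q i).2 ≠ (q j).2 := fun heq => by
        rcases lt_or_gt_of_ne (p.injective.ne hij) with h | h
        · exact ((hqy i j).1 h).ne heq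
        · exact ((hqy j i).1 h).ne heq.symm
      simp only [hx, hy] at hxne hyne ⊢
      exact ⟨coord_lt_coord_iff (h0 i) (h1 i) (h0 j) (h1 j) hxne (hτd i j) (hτd j i),
        coord_lt_coord_iff (h0 i) (h1 i) (h0 j) (h1 j) hyne (hτd i j) (hτd j i)⟩
  obtain ⟨v, ρ, h, -, -⟩ := hdraw.exists_encodes hτ
  exact ⟨v, ρ, h⟩

end Figure

end GeomGrid

theorem mainTheorem3 (C : Set GeomGrid.Permutation)
    (hC : GeomGrid.IsGeometricallyGriddable C) :
    (∃ (α : Type) (_ : Fintype α) (L : Language α), L.IsRegular ∧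
      ∃ e : {π : GeomGrid.Permutation // π ∈ C} ≃ {w : List α // w ∈ L},
        ∀ π : {π : GeomGrid.Permutation // π ∈ C}, (e π).1.length = π.1.length) ∧
    GeomGrid.IsRationalSeries (GeomGrid.genFun C) := by
  obtain ⟨hC, t, u, M, hM⟩ := hC
  obtain ⟨L, hL, e, he⟩ := GeomGrid.exists_isRegular_equiv hC
    fun n p hp => GeomGrid.exists_encodes_of_mem_geom (hM hp)
  refine ⟨⟨_, inferInstance, L, hL, e, he⟩, ?_⟩
  obtain ⟨P, Q, hQ, hPQ⟩ := hL.exists_polynomial_mul_eq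
  refine ⟨P, Q, hQ, ?_⟩
  rw [← hPQ]
  congr 1
  ext n
  simp only [GeomGrid.genFun, PowerSeries.coeff_mk, Nat.cast_inj]
  refine Set.ncard_congr (fun p hp => (e ⟨⟨n, p⟩, hp⟩).1) (fun p hp => ?_)
    (fun p p' hp hp' heq => ?_) fun w hw => ?_
  · exact ⟨(e ⟨⟨n, p⟩, hp⟩).2, he _⟩
  · have := e.injective (Subtype.ext heq)
    simpa using this
  · obtain ⟨π, hπ⟩ := e.surjective ⟨w, hw.1⟩
    have hlen := he π
    rw [hπ] at hlen
    obtain ⟨⟨m, p⟩, hp⟩ := π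
    obtain rfl : n = m := hw.2.symm.trans hlen
    exact ⟨p, hp, by rw [hπ]⟩
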